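/- Let $\mathbb K$ be an algebraically closed field of characteristic zero, $K$ a finitely generated abelian group, and $R=\bigoplus_{w\in K}R_w$ an integral (i.e. an integral domain), finitely generated, commutative $\mathbb K$-algebra graded by $K$. Let $\omega(R)=\{w\in K : R_w\neq 0\}$ be the weight monoid. Assume that the grading is effective, i.e. $\omega(R)$ generates $K$ as a group, and pointed, i.e. $R_0=\mathbb K$ and the convex cone generated by $\omega(R)$ in $K_{\mathbb Q}=K\otimes_{\mathbb Z}\mathbb Q$ contains no line. For $w',w\in\omega(R)$ write $w'\le w$ if $w=w'+w_0$ for some $w_0\in\omega(R)$, and $w'<w$ if moreover $w'\neq w$; let $R_{<w}\subseteq R$ be the subalgebra generated by all $R_{w'}$ with $w'\in\omega(R)$, $w'<w$, and let $\Omega_R=\{w\in\omega(R) : R_w\not\subseteq R_{<w}\}$ be the set of generator degrees. Let $\mathrm{Aut}_K(R)$ be the group of graded automorphisms of $R$, i.e. of pairs $(\varphi,\psi)$ of a $\mathbb K$-algebra automorphism $\varphi$ of $R$ and an automorphism $\psi$ of $K$ with $\varphi(R_w)=R_{\psi(w)}$ for all $w\in K$. Then $\mathrm{Aut}_K(R)$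 is an affine algebraic group, with coordinate ring the algebra of functions generated by all $(\varphi,\psi)\mapsto\ell(\varphi(f))$ and $(\varphi,\psi)\mapsto\ell(\varphi^{-1}(f))$, where $f\in R$ and $\ell$ is a linear form on $R$; the set $\Omega_R$ is finite, the spaces $R_w$, $w\in\Omega_R$, are finite dimensional, and $$\dim(\mathrm{Aut}_K(R))\ \le\ \sum_{w\in\Omega_R}\dim(R_w)^2 .$$ -/

import Mathlib

open scoped TensorProduct

namespace GradedAlg

section Grading

variable {𝕜 R K : Type*} [Field 𝕜] [CommRing R] [Algebra 𝕜 R] [AddCommGroup K]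

/-- The weight monoid `ω(R)`: all degrees `w` with `R_w ≠ 0`. -/
def weightMonoid (𝒜 : K → Submodule 𝕜 R) : Set K := {w | 𝒜 w ≠ ⊥}

/-- The grading is effective if `ω(R)` generates `K` as a group. -/
def IsEffective (𝒜 : K → Submodule 𝕜 R) : Prop :=
  AddSubgroup.closure (weightMonoid 𝒜) = ⊤

/-- The convex cone in `K_ℚ = ℚ ⊗ K` generated by `ω(R)`. -/
noncomputable def weightCone (𝒜 : K → Submodule 𝕜 R) : PointedCone ℚ (ℚ ⊗[ℤ] K) :=
  PointedCone.hull ℚ ((fun w : K => (1 : ℚ) ⊗ₜ[ℤ] w) '' weightMonoid 𝒜)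

/-- The grading is pointed if `R_0 = 𝕜` and the cone generated by `ω(R)` in `K_ℚ` contains
no line. -/
def IsPointed (𝒜 : K → Submodule 𝕜 R) : Prop :=
  𝒜 0 = Subalgebra.toSubmodule (⊥ : Subalgebra 𝕜 R) ∧
    ¬ ∃ v : ℚ ⊗[ℤ] K, v ≠ 0 ∧ ∀ t : ℚ, t • v ∈ weightCone 𝒜

/-- The strict part `w' < w` of the relation on `ω(R)` given by `w' ≤ w` if `w = w' + w₀` for
some `w₀ ∈ ω(R)`. -/
def weightLT (𝒜 : K → Submodule 𝕜 R) (w' w : K) : Prop :=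
  (∃ w₀ ∈ weightMonoid 𝒜, w = w' + w₀) ∧ w' ≠ w

/-- The subalgebra `R_{<w}` generated by all `R_{w'}` with `w' ∈ ω(R)`, `w' < w`. -/
def below (𝒜 : K → Submodule 𝕜 R) (w : K) : Subalgebra 𝕜 R :=
  Algebra.adjoin 𝕜 {f | ∃ w' ∈ weightMonoid 𝒜, weightLT 𝒜 w' w ∧ f ∈ 𝒜 w'}

/-- The set `Ω_R` of generator degrees. -/
def generatorDegrees (𝒜 : K → Submodule 𝕜 R) : Set K :=
  {w | w ∈ weightMonoid 𝒜 ∧ ¬ 𝒜 w ≤ Subalgebra.toSubmodule (below 𝒜 w)}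

/-- A graded automorphism of `R`: a pair `(φ, ψ)` of an algebra automorphism of `R` and an
automorphism of `K` such that `φ(R_w) ⊆ R_{ψ(w)}` for all `w`, and likewise for the inverse
pair. -/
@[ext]
structure GradedAut (𝒜 : K → Submodule 𝕜 R) where
  /-- The algebra automorphism. -/
  φ : R ≃ₐ[𝕜] R
  /-- The automorphism of the grading group. -/
  ψ : K ≃+ K
  mem_iff : ∀ (w : K) (f : R), f ∈ 𝒜 w ↔ φ f ∈ 𝒜 (ψ w)

/-- The group `Aut_K(R)` of graded automorphisms, with composition as multiplication. -/
instance GradedAut.instGroup (𝒜 : K → Submodule 𝕜 R) : Group (GradedAut 𝒜) where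
  mul a b := ⟨b.φ.trans a.φ, b.ψ.trans a.ψ,
    fun w f => (b.mem_iff w f).trans (a.mem_iff (b.ψ w) (b.φ f))⟩
  one := ⟨AlgEquiv.refl, AddEquiv.refl K, fun _ _ => Iff.rfl⟩
  inv a := ⟨a.φ.symm, a.ψ.symm, fun w f => by
    simpa using (a.mem_iff (a.ψ.symm w) (a.φ.symm f)).symm⟩
  mul_assoc _ _ _ := rfl
  one_mul _ := rfl
  mul_one _ := rfl
  inv_mul_cancel a := GradedAut.ext
    (AlgEquiv.ext fun f => a.φ.symm_apply_apply f)
    (AddEquiv.ext fun w => a.ψ.symm_apply_apply w)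

/-- The regular functions on `Aut_K(R)`: the algebra generated by the matrix coefficients
`(φ, ψ) ↦ ℓ(φ(f))` of the natural representation on `R` and their composites
`(φ, ψ) ↦ ℓ(φ⁻¹(f))` with the inversion, for `f ∈ R` and linear forms `ℓ` on `R`. -/
def regularFunctions (𝒜 : K → Submodule 𝕜 R) : Subalgebra 𝕜 (GradedAut 𝒜 → 𝕜) :=
  Algebra.adjoin 𝕜
    {c | ∃ (f : R) (ℓ : Module.Dual 𝕜 R),
      (c = fun g => ℓ (g.φ f)) ∨ (c = fun g => ℓ (g⁻¹.φ f))}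

end Grading

section AlgebraicGroup

variable {𝕜 G : Type*} [Field 𝕜] [Group G]

/-- The algebra `A` of `𝕜`-valued functions on the group `G` is the coordinate ring of an affine
algebraic group over the (algebraically closed) field `𝕜` with underlying group `G`: `A` is
finitely generated, the points of `G` are exactly the `𝕜`-algebra homomorphisms `A → 𝕜`, and
multiplication and inversion are morphisms. -/
structure IsAffineAlgebraicGroup (A : Subalgebra 𝕜 (G → 𝕜)) : Prop where
  fg : A.FG
  bijective_eval :
    Function.Bijective (fun g : G => (Pi.evalAlgHom 𝕜 (fun _ : G => 𝕜) g).comp A.val)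
  mul : ∀ a ∈ A, ∃ (n : ℕ) (b c : Fin n → A),
    ∀ g h : G, a (g * h) = ∑ i, (b i : G → 𝕜) g * (c i : G → 𝕜) h
  inv : ∀ a ∈ A, (fun g : G => a g⁻¹) ∈ A

/-- The dimension of the affine algebraic group with coordinate ring `A`. -/
noncomputable def algGroupDim (A : Subalgebra 𝕜 (G → 𝕜)) : WithBot ℕ∞ := ringKrullDim A

end AlgebraicGroup

end GradedAlg

open scoped TensorProduct

namespace GradedAlg

/-! ### Weights, finiteness of degrees, and generation in the degrees `Ω_R` -/

section Weights

variable {𝕜 R K : Type*} [Field 𝕜] [CommRing R] [Algebra 𝕜 R] {𝒜 : K → Submodule 𝕜 R}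

/-! Pointedness leaves `0` as the only unit of `ω(R)`, so a weight is a sum of degrees of
nonconstant homogeneous generators in only finitely many ways (`finite_weight_fibre`). Hence every
`R_w` is finite dimensional, `Ω_R` is finite, and induction on the length of monomials shows that
the `R_w`, `w ∈ Ω_R`, generate `R`.

A graded automorphism permutes `Ω_R`, which generates `K`, so only finitely many `ψ` occur. The
group is thus a finite union of pieces with fixed `ψ`. Translating a piece by one of its elements
makes all its members preserve every `R_w`, that is, block diagonal on the sum of the `R_w`, `w ∈
Ω_R`. By Cramer's rule the functions on a piece are fractions, with invertible denominators, of
polynomials in the `∑ dim(R_w)²` block entries, which bounds the Krull dimension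
(`ringKrullDim_le_of_blocks`).

For the group structure, each orbit map `g ↦ φ(f)` comes from a tensor in `A ⊗ R`, where `A` is the
algebra of regular functions. Evaluating it at a character `χ` of `A` gives an endomorphism of `R`,
inverse to the one obtained from `g ↦ φ⁻¹(f)`. The kernel of `χ` is prime, so it contains the ideal
of one piece, and this supplies `ψ` (`IsPointed.exists_eval_eq`). -/

theorem mem_weightMonoid_of_mem {w : K} {f : R} (hf : f ∈ 𝒜 w) (h0 : f ≠ 0) :
    w ∈ weightMonoid 𝒜 := fun h => h0 (by simpa [h] using hf)

theorem exists_mem_ne_zero {w : K} (hw : w ∈ weightMonoid 𝒜) : ∃ f ∈ 𝒜 w, f ≠ 0 :=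
  Submodule.exists_mem_ne_zero_of_ne_bot hw

theorem torsion_of_tmul_eq_zero [AddCommGroup K] {u : K} (h : (1 : ℚ) ⊗ₜ[ℤ] u = 0) :
    ∃ n : ℕ, 0 < n ∧ n • u = 0 := by
  obtain ⟨s, hs⟩ := (IsLocalizedModule.eq_zero_iff (nonZeroDivisors ℤ)
    (TensorProduct.mk ℤ ℚ K 1)).1 h
  have hs0 : (s : ℤ) ≠ 0 := nonZeroDivisors.ne_zero s.2
  refine ⟨(s : ℤ).natAbs, Int.natAbs_pos.2 hs0, ?_⟩
  have hs' : (s : ℤ) • u = 0 := hs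
  rcases Int.natAbs_eq (s : ℤ) with h1 | h1
  · rw [h1] at hs'
    simpa using hs'
  · rw [h1] at hs'
    simpa using hs'

theorem mem_range_algebraMap_of_isIntegral [IsAlgClosed 𝕜] [IsDomain R] {f : R}
    (hf : IsIntegral 𝕜 f) : ∃ c : 𝕜, algebraMap 𝕜 R c = f := by
  obtain ⟨c, hc⟩ := (IsAlgClosed.algebraMap_bijective_of_isIntegral
    (k := 𝕜) (K := integralClosure 𝕜 R)).2 ⟨f, hf⟩
  exact ⟨c, congrArg Subtype.val hc⟩

/-- Finitely many nonconstant homogeneous generators of `R`. -/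
structure HomogeneousGenerators [AddCommGroup K] (𝒜 : K → Submodule 𝕜 R) (ι : Type*) where
  gen : ι → R
  deg : ι → K
  gen_mem : ∀ i, gen i ∈ 𝒜 (deg i)
  gen_ne_zero : ∀ i, gen i ≠ 0
  deg_ne_zero : ∀ i, deg i ≠ 0
  adjoin_eq_top : Algebra.adjoin 𝕜 (Set.range gen) = ⊤

theorem HomogeneousGenerators.deg_mem [AddCommGroup K] {ι : Type*} 
    (X : HomogeneousGenerators 𝒜 ι) (i : ι) :
    X.deg i ∈ weightMonoid 𝒜 :=
  mem_weightMonoid_of_mem (X.gen_mem i) (X.gen_ne_zero i)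

variable [AddCommGroup K] [DecidableEq K] [GradedAlgebra 𝒜]

theorem eq_of_mem_of_mem {u w : K} {f : R} (hu : f ∈ 𝒜 u) (hw : f ∈ 𝒜 w) (h0 : f ≠ 0) :
    u = w := by
  by_contra h
  apply h0
  rw [← DirectSum.decompose_of_mem_same 𝒜 hw, DirectSum.decompose_of_mem_ne 𝒜 hu h]

theorem zero_mem_weightMonoid [Nontrivial R] : (0 : K) ∈ weightMonoid 𝒜 :=
  mem_weightMonoid_of_mem (SetLike.GradedOne.one_mem (A := 𝒜)) one_ne_zero

theorem add_mem_weightMonoid [IsDomain R] {u w : K} (hu : u ∈ weightMonoid 𝒜)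
    (hw : w ∈ weightMonoid 𝒜) : u + w ∈ weightMonoid 𝒜 := by
  obtain ⟨f, hf, hf0⟩ := exists_mem_ne_zero hu
  obtain ⟨g, hg, hg0⟩ := exists_mem_ne_zero hw
  exact mem_weightMonoid_of_mem (SetLike.mul_mem_graded hf hg) (mul_ne_zero hf0 hg0)

theorem weight_mem_weightMonoid [IsDomain R] {ι : Type*} {d : ι → K}
    (hd : ∀ i, d i ∈ weightMonoid 𝒜) (a : ι →₀ ℕ) : Finsupp.weight d a ∈ weightMonoid 𝒜 := by
  induction a using Finsupp.induction_linear with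
  | zero => simpa using zero_mem_weightMonoid
  | add a b ha hb => rw [map_add]; exact add_mem_weightMonoid ha hb
  | single i n =>
    induction n with
    | zero => simpa using zero_mem_weightMonoid
    | succ n ih =>
      rw [Finsupp.single_add, map_add]
      exact add_mem_weightMonoid ih (by simpa [Finsupp.weight_apply] using hd i)

/-- Opposite weights span a line in the cone unless they vanish in `K_ℚ`, so `u` is torsion. A power
of a nonzero `f ∈ R_u` then lies in `R_0 = 𝕜`, so `f` is algebraic over `𝕜`, hence constant, of
degree `0`. -/
theorem IsPointed.eq_zero_of_add_eq_zero [IsAlgClosed 𝕜] [IsDomain R] (hpt : IsPointed 𝒜)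
    {u v : K} (hu : u ∈ weightMonoid 𝒜) (hv : v ∈ weightMonoid 𝒜) (huv : u + v = 0) :
    u = 0 := by
  have hmem : ∀ w ∈ weightMonoid 𝒜, ∀ t : ℚ, 0 ≤ t →
      t • ((1 : ℚ) ⊗ₜ[ℤ] w) ∈ weightCone 𝒜 := fun w hw t ht =>
    (weightCone 𝒜).smul_mem ht (Submodule.subset_span (Set.mem_image_of_mem _ hw))
  have h1 : (1 : ℚ) ⊗ₜ[ℤ] u = 0 := by
    by_contra h0
    refine hpt.2 ⟨(1 : ℚ) ⊗ₜ[ℤ] u, h0, fun t => ?_⟩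
    rcases le_total 0 t with ht | ht
    · exact hmem u hu t ht
    · have := hmem v hv (-t) (neg_nonneg.2 ht)
      rw [eq_neg_of_add_eq_zero_right huv, TensorProduct.tmul_neg, smul_neg, neg_smul,
        neg_neg] at this
      exact this
  obtain ⟨n, hn, hnu⟩ := torsion_of_tmul_eq_zero h1
  obtain ⟨f, hf, hf0⟩ := exists_mem_ne_zero hu
  have hfn : f ^ n ∈ 𝒜 0 := hnu ▸ SetLike.pow_mem_graded n hf
  rw [hpt.1] at hfn
  obtain ⟨c, hc⟩ := Algebra.mem_bot.1 hfn
  have hint : IsIntegral 𝕜 f := IsIntegral.of_pow hn (hc ▸ isIntegral_algebraMap)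
  obtain ⟨z, rfl⟩ := mem_range_algebraMap_of_isIntegral hint
  exact eq_of_mem_of_mem hf (hpt.1 ▸ Subalgebra.algebraMap_mem _ z) hf0

/-- In a monoid of weights without units, an element has only finitely many expressions as a sum
of given nonzero elements. -/
theorem finite_weight_fibre [IsAlgClosed 𝕜] [IsDomain R] (hpt : IsPointed 𝒜) {ι : Type*}
    [Finite ι] {d : ι → K} (hd : ∀ i, d i ∈ weightMonoid 𝒜) (hd0 : ∀ i, d i ≠ 0) (w : K) :
    {a : ι →₀ ℕ | Finsupp.weight d a = w}.Finite := by
  -- Dickson's lemma: it suffices that the fibre is an antichain, and two comparable elements would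
  -- differ by a nonzero exponent of weight `0`.
  refine IsAntichain.finite_of_partiallyWellOrderedOn (r := (· ≤ ·)) ?_
    (Set.isPWO_of_wellQuasiOrderedLE _)
  rintro a (ha : _ = w) b (hb : _ = w) hab hle
  obtain ⟨c, rfl⟩ := exists_add_of_le hle
  have hc : c ≠ 0 := by rintro rfl; simp at hab
  rw [map_add, ha, add_eq_left] at hb
  obtain ⟨i, hi⟩ := Finsupp.ne_iff.1 hc
  have h1 : Finsupp.single i 1 ≤ c := by
    rw [Finsupp.single_le_iff]
    exact Nat.one_le_iff_ne_zero.2 hi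
  obtain ⟨e, rfl⟩ := exists_add_of_le h1
  rw [map_add, Finsupp.weight_single, one_smul] at hb
  exact hd0 i (hpt.eq_zero_of_add_eq_zero (hd i) (weight_mem_weightMonoid hd e) hb)

/-- A homogeneous component is spanned by the monomials of its degree in homogeneous
generators. -/
theorem mem_span_monomials {ι : Type*} {x : ι → R} {d : ι → K} (hx : ∀ i, x i ∈ 𝒜 (d i))
    (hgen : Algebra.adjoin 𝕜 (Set.range x) = ⊤) {w : K} {f : R} (hf : f ∈ 𝒜 w) :
    f ∈ Submodule.span 𝕜 ((fun a : ι →₀ ℕ => a.prod fun i n => x i ^ n) ''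
      {a | Finsupp.weight d a = w}) := by
  have hf' : f ∈ (MvPolynomial.aeval x : MvPolynomial ι 𝕜 →ₐ[𝕜] R).range := by
    rw [← Algebra.adjoin_range_eq_range_aeval, hgen]; trivial
  obtain ⟨p, rfl⟩ := AlgHom.mem_range _ |>.1 hf'
  have key : GradedAlgebra.proj 𝒜 w (MvPolynomial.aeval x p) ∈
      Submodule.span 𝕜 ((fun a : ι →₀ ℕ => a.prod fun i n => x i ^ n) ''
        {a | Finsupp.weight d a = w}) := by
    clear hf hf'
    induction p using MvPolynomial.induction_on' with
    | add p q hp hq => rw [map_add, map_add]; exact add_mem hp hq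
    | monomial a c =>
      rw [MvPolynomial.aeval_monomial, ← Algebra.smul_def, map_smul]
      refine Submodule.smul_mem _ _ ?_
      have ha : (a.prod fun i n => x i ^ n) ∈ 𝒜 (Finsupp.weight d a) := by
        rw [Finsupp.weight_apply]
        exact SetLike.prod_pow_mem_graded 𝒜 d x a fun i _ => hx i
      rw [GradedAlgebra.proj_apply]
      by_cases h : Finsupp.weight d a = w
      · rw [DirectSum.decompose_of_mem_same 𝒜 (h ▸ ha)]
        exact Submodule.subset_span ⟨a, h, rfl⟩
      · rw [DirectSum.decompose_of_mem_ne 𝒜 ha h]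
        exact zero_mem _
  rwa [GradedAlgebra.proj_apply, DirectSum.decompose_of_mem_same 𝒜 hf] at key

theorem exists_homogeneous_generators [Algebra.FiniteType 𝕜 R] (hpt : IsPointed 𝒜) :
    ∃ (s : Finset R) (d : R → K), (∀ x ∈ s, x ∈ 𝒜 (d x)) ∧ (∀ x ∈ s, x ≠ 0) ∧
      (∀ x ∈ s, d x ≠ 0) ∧ Algebra.adjoin 𝕜 (s : Set R) = ⊤ := by
  classical
  obtain ⟨F, hF⟩ := Algebra.FiniteType.out (R := 𝕜) (A := R)
  let t : Finset R := F.biUnion fun f =>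
    (DirectSum.decompose 𝒜 f).support.image fun w => ((DirectSum.decompose 𝒜 f) w : R)
  have ht : ∀ x ∈ t, ∃ w, x ∈ 𝒜 w := by
    intro x hx
    simp only [t, Finset.mem_biUnion, Finset.mem_image] at hx
    obtain ⟨f, -, w, -, rfl⟩ := hx
    exact ⟨w, SetLike.coe_mem _⟩
  choose! d hd using ht
  refine ⟨t.filter fun x => d x ≠ 0 ∧ x ≠ 0, d, fun x hx => hd x (Finset.mem_filter.1 hx).1,
    fun x hx => (Finset.mem_filter.1 hx).2.2, fun x hx => (Finset.mem_filter.1 hx).2.1, ?_⟩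
  rw [← top_le_iff, ← hF, Algebra.adjoin_le_iff]
  intro f hf
  rw [SetLike.mem_coe, ← DirectSum.sum_support_decompose 𝒜 f]
  refine sum_mem fun w hw => ?_
  set x : R := ((DirectSum.decompose 𝒜 f) w : R) with hx
  have hxt : x ∈ t := Finset.mem_biUnion.2 ⟨f, hf, Finset.mem_image.2 ⟨w, hw, rfl⟩⟩
  by_cases h0 : x = 0
  · rw [h0]; exact zero_mem _
  by_cases hd0 : d x = 0
  · have : x ∈ 𝒜 0 := hd0 ▸ hd x hxt
    rw [hpt.1] at this
    obtain ⟨c, hc⟩ := Algebra.mem_bot.1 this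
    rw [← hc]
    exact Subalgebra.algebraMap_mem _ _
  · exact Algebra.subset_adjoin (Finset.mem_coe.2 (Finset.mem_filter.2 ⟨hxt, hd0, h0⟩))

theorem exists_weight_eq {ι : Type*} {x : ι → R} {d : ι → K} (hx : ∀ i, x i ∈ 𝒜 (d i))
    (hgen : Algebra.adjoin 𝕜 (Set.range x) = ⊤) {w : K} (hw : w ∈ weightMonoid 𝒜) :
    ∃ a : ι →₀ ℕ, Finsupp.weight d a = w := by
  obtain ⟨f, hf, hf0⟩ := exists_mem_ne_zero hw
  by_contra h
  have hempty : {a : ι →₀ ℕ | Finsupp.weight d a = w} = ∅ :=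
    Set.eq_empty_of_forall_notMem fun a ha => h ⟨a, ha⟩
  have := mem_span_monomials hx hgen hf
  rw [hempty, Set.image_empty, Submodule.span_empty] at this
  exact hf0 (by simpa using this)

theorem exists_homogeneousGenerators [Algebra.FiniteType 𝕜 R] (hpt : IsPointed 𝒜) :
    ∃ n : ℕ, Nonempty (HomogeneousGenerators 𝒜 (Fin n)) := by
  obtain ⟨s, d, h1, h2, h3, h4⟩ := exists_homogeneous_generators hpt
  let e := s.equivFin.symm
  refine ⟨s.card, ⟨⟨fun i => e i, fun i => d (e i), fun i => h1 _ (e i).2, fun i => h2 _ (e i).2,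
    fun i => h3 _ (e i).2, ?_⟩⟩⟩
  rw [← h4]
  congr 1
  have : Set.range (fun i => (e i : R)) = Set.range (Subtype.val ∘ e) := rfl
  rw [this, EquivLike.range_comp]
  simp

namespace HomogeneousGenerators

variable {ι : Type*} (X : HomogeneousGenerators 𝒜 ι)

theorem exists_weight_deg_eq {w : K} (hw : w ∈ weightMonoid 𝒜) :
    ∃ a : ι →₀ ℕ, Finsupp.weight X.deg a = w :=
  exists_weight_eq X.gen_mem X.adjoin_eq_top hw

/-- If no generator has degree `w`, every factor of a monomial of degree `w` has degree strictly
below `w`, so `R_w ⊆ R_{<w}`. -/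
theorem generatorDegrees_subset [IsDomain R] : generatorDegrees 𝒜 ⊆ Set.range X.deg := by
  rintro w ⟨hw, hnot⟩
  by_contra hr
  refine hnot fun f hf => ?_
  refine Submodule.span_le.2 ?_ (mem_span_monomials X.gen_mem X.adjoin_eq_top hf)
  rintro _ ⟨a, ha : _ = w, rfl⟩
  change _ ∈ below 𝒜 w
  refine prod_mem fun i hi => pow_mem (?_ : X.gen i ∈ below 𝒜 w) _
  refine Algebra.subset_adjoin ⟨X.deg i, X.deg_mem i, ⟨?_, ?_⟩, X.gen_mem i⟩
  · have h1 : Finsupp.single i 1 ≤ a := by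
      rw [Finsupp.single_le_iff]
      exact Nat.one_le_iff_ne_zero.2 (Finsupp.mem_support_iff.1 hi)
    obtain ⟨e, rfl⟩ := exists_add_of_le h1
    exact ⟨_, weight_mem_weightMonoid X.deg_mem e, by
      rw [← ha, map_add, Finsupp.weight_single, one_smul]⟩
  · rintro rfl
    exact hr ⟨i, rfl⟩

variable [IsAlgClosed 𝕜] [IsDomain R] [Finite ι]

theorem finite_component (X : HomogeneousGenerators 𝒜 ι) (hpt : IsPointed 𝒜) (w : K) : Module.Finite 𝕜 (𝒜 w) := by
  have hfin := (finite_weight_fibre hpt X.deg_mem X.deg_ne_zero w).image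
    (fun a : ι →₀ ℕ => a.prod fun i n => X.gen i ^ n)
  have := FiniteDimensional.span_of_finite 𝕜 hfin
  exact Submodule.finiteDimensional_of_le
    fun f hf => mem_span_monomials X.gen_mem X.adjoin_eq_top hf

/-- The largest number of factors in a monomial of degree `w`. -/
noncomputable def height (hpt : IsPointed 𝒜) (w : K) : ℕ :=
  (finite_weight_fibre hpt X.deg_mem X.deg_ne_zero w).toFinset.sup Finsupp.degree

/-- A longest monomial of degree `w'` becomes longer on multiplication by one of degree `w₀ ≠ 0`.
This makes `weightLT` well founded on weights. -/
theorem height_lt (hpt : IsPointed 𝒜) {w' w : K} (hw' : w' ∈ weightMonoid 𝒜)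
    (h : weightLT 𝒜 w' w) : X.height hpt w' < X.height hpt w := by
  obtain ⟨⟨w₀, hw₀, rfl⟩, hne⟩ := h
  obtain ⟨a₀, ha₀⟩ := X.exists_weight_deg_eq hw₀
  obtain ⟨b, hb⟩ := X.exists_weight_deg_eq hw'
  obtain ⟨a, ha, hmax⟩ := Finset.exists_mem_eq_sup
    (finite_weight_fibre hpt X.deg_mem X.deg_ne_zero w').toFinset ⟨b, by simpa using hb⟩
    Finsupp.degree
  have ha' : Finsupp.weight X.deg a = w' := by simpa using ha
  have h0 : a₀ ≠ 0 := by
    rintro rfl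
    apply hne
    rw [← ha₀, map_zero, add_zero]
  have hpos : 0 < Finsupp.degree a₀ := Nat.pos_of_ne_zero (mt (Finsupp.degree_eq_zero_iff a₀).1 h0)
  have hle : Finsupp.degree (a + a₀) ≤ X.height hpt (w' + w₀) :=
    Finset.le_sup (f := Finsupp.degree) (by simp [ha', ha₀])
  rw [map_add] at hle
  have : X.height hpt w' = Finsupp.degree a := hmax
  omega

theorem component_le_adjoin (X : HomogeneousGenerators 𝒜 ι) (hpt : IsPointed 𝒜) (w : K) :
    𝒜 w ≤ Subalgebra.toSubmodule
      (Algebra.adjoin 𝕜 (⋃ v ∈ generatorDegrees 𝒜, (𝒜 v : Set R))) := by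
  induction hn : X.height hpt w using Nat.strong_induction_on generalizing w with
  | _ n ih =>
    subst hn
    by_cases hw : w ∈ weightMonoid 𝒜
    · by_cases hg : w ∈ generatorDegrees 𝒜
      · exact fun f hf => Algebra.subset_adjoin (Set.mem_biUnion hg hf)
      · have hle : 𝒜 w ≤ Subalgebra.toSubmodule (below 𝒜 w) := by
          by_contra h
          exact hg ⟨hw, h⟩
        refine hle.trans ?_
        refine Algebra.adjoin_le (S := Algebra.adjoin 𝕜
          (⋃ v ∈ generatorDegrees 𝒜, (𝒜 v : Set R))) ?_
        rintro f ⟨w', hw', hlt, hf⟩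
        exact ih _ (X.height_lt hpt hw' hlt) w' rfl hf
    · have : 𝒜 w = ⊥ := not_not.1 hw
      rw [this]
      exact bot_le

end HomogeneousGenerators

theorem IsPointed.finite_generatorDegrees [IsDomain R] [Algebra.FiniteType 𝕜 R]
    (hpt : IsPointed 𝒜) : (generatorDegrees 𝒜).Finite := by
  obtain ⟨n, ⟨X⟩⟩ := exists_homogeneousGenerators hpt
  exact (Set.finite_range _).subset X.generatorDegrees_subset

variable [IsAlgClosed 𝕜] [IsDomain R] [Algebra.FiniteType 𝕜 R]

theorem IsPointed.finite_component (hpt : IsPointed 𝒜) (w : K) : Module.Finite 𝕜 (𝒜 w) := by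
  obtain ⟨n, ⟨X⟩⟩ := exists_homogeneousGenerators hpt
  exact X.finite_component hpt w

theorem IsPointed.adjoin_generatorDegrees (hpt : IsPointed 𝒜) :
    Algebra.adjoin 𝕜 (⋃ v ∈ generatorDegrees 𝒜, (𝒜 v : Set R)) = ⊤ := by
  classical
  obtain ⟨n, ⟨X⟩⟩ := exists_homogeneousGenerators hpt
  rw [← top_le_iff]
  intro f _
  rw [← DirectSum.sum_support_decompose 𝒜 f]
  exact sum_mem fun w _ => X.component_le_adjoin hpt w (SetLike.coe_mem _)

theorem IsPointed.weightMonoid_subset_closure (hpt : IsPointed 𝒜) :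
    weightMonoid 𝒜 ⊆ AddSubgroup.closure (generatorDegrees 𝒜) := by
  intro w hw
  let x : (Σ v : generatorDegrees 𝒜, 𝒜 v) → R := fun i => i.2
  have hx : Algebra.adjoin 𝕜 (Set.range x) = ⊤ := by
    rw [← top_le_iff, ← hpt.adjoin_generatorDegrees, Algebra.adjoin_le_iff]
    intro g hg
    obtain ⟨v, hv, hg⟩ := Set.mem_iUnion₂.1 hg
    exact Algebra.subset_adjoin ⟨⟨⟨v, hv⟩, ⟨g, hg⟩⟩, rfl⟩
  obtain ⟨a, rfl⟩ := exists_weight_eq (𝒜 := 𝒜) (x := x) (d := fun i => (i.1 : K))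
    (fun i => i.2.2) hx hw
  rw [Finsupp.weight_apply]
  exact sum_mem fun i _ => nsmul_mem (AddSubgroup.subset_closure i.1.2) _

end Weights

/-! ### Two bounds for the Krull dimension -/

section KrullDimension

/-- If every element of `S` is a fraction of elements of the image of `P`, then the dimension of
`S` is at most that of `P`. -/
theorem ringKrullDim_le_of_fractions {P S : Type*} [CommRing P] [CommRing S] (f : P →+* S)
    (h : ∀ a, ∃ s p, IsUnit (f s) ∧ f s * a = f p) : ringKrullDim S ≤ ringKrullDim P := by
  -- Contraction of primes is strictly monotone: `a` lies in a prime iff its numerator does, the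
  -- denominator being a unit.
  refine Order.krullDim_le_of_strictMono (PrimeSpectrum.comap f) fun q q' hlt => ?_
  refine lt_of_le_not_ge (Ideal.comap_mono hlt.le) fun hge => ?_
  refine hlt.not_ge fun a ha => ?_
  obtain ⟨s, p, hs, hsp⟩ := h a
  have h1 : p ∈ (PrimeSpectrum.comap f q').asIdeal := by
    change f p ∈ q'.asIdeal
    rw [← hsp]
    exact Ideal.mul_mem_left _ _ ha
  have h2 : f s * a ∈ q.asIdeal := by
    rw [hsp]
    exact hge h1
  exact (Ideal.unit_mul_mem_iff_mem _ hs).1 h2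

/-- The smallest prime of a chain contains the intersection of the `I i`, hence one `I i`, so the
whole chain lives in `A ⧸ I i`. -/
theorem ringKrullDim_le_of_iInf_eq_bot {A ι : Type*} [CommRing A] [Finite ι] (I : ι → Ideal A)
    (hI : ⨅ i, I i = ⊥) {n : WithBot ℕ∞} (h : ∀ i, ringKrullDim (A ⧸ I i) ≤ n) :
    ringKrullDim A ≤ n := by
  cases nonempty_fintype ι
  refine iSup_le fun l => ?_
  have hhead : Finset.univ.inf I ≤ l.head.asIdeal := by
    rw [Finset.inf_univ_eq_iInf, hI]
    exact bot_le
  obtain ⟨i, -, hi⟩ := (Ideal.IsPrime.inf_le' l.head.2).1 hhead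
  refine le_trans ?_ (h i)
  rw [ringKrullDim, Order.krullDim_eq_of_orderIso (I i).primeSpectrumQuotientOrderIsoZeroLocus]
  let l' : LTSeries (PrimeSpectrum.zeroLocus (I i : Set A)) :=
    { length := l.length
      toFun := fun j => ⟨l j, hi.trans (l.head_le j)⟩
      step := fun j => l.step j }
  exact Order.LTSeries.length_le_krullDim l'

theorem ringKrullDim_le_of_iInf_ker_eq_bot {A ι : Type*} {S : ι → Type*} [CommRing A] [Finite ι]
    [∀ i, CommRing (S i)] (τ : ∀ i, A →+* S i) (hτ : ∀ i, Function.Surjective (τ i))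
    (hinf : ⨅ i, RingHom.ker (τ i) = ⊥) {n : WithBot ℕ∞} (h : ∀ i, ringKrullDim (S i) ≤ n) :
    ringKrullDim A ≤ n :=
  ringKrullDim_le_of_iInf_eq_bot _ hinf fun i =>
    (ringKrullDim_eq_of_ringEquiv (RingHom.quotientKerEquivOfSurjective (hτ i))).le.trans (h i)

/-- The elements of `S` that are fractions of elements of the image of `P`. -/
def fractionSubalgebra {𝕜 P S : Type*} [CommRing 𝕜] [CommRing P] [CommRing S] [Algebra 𝕜 P]
    [Algebra 𝕜 S] (f : P →ₐ[𝕜] S) : Subalgebra 𝕜 S where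
  carrier := {a | ∃ s p, IsUnit (f s) ∧ f s * a = f p}
  mul_mem' := by
    rintro a b ⟨s, p, hs, h⟩ ⟨s', p', hs', h'⟩
    exact ⟨s * s', p * p', by rw [map_mul]; exact hs.mul hs', by
      rw [map_mul, map_mul, ← h, ← h']; ring⟩
  add_mem' := by
    rintro a b ⟨s, p, hs, h⟩ ⟨s', p', hs', h'⟩
    exact ⟨s * s', s' * p + s * p', by rw [map_mul]; exact hs.mul hs', by
      rw [map_mul, map_add, map_mul, map_mul, ← h, ← h']; ring⟩
  algebraMap_mem' c := ⟨1, algebraMap 𝕜 P c, by simp, by simp⟩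

end KrullDimension

/-! ### Regular families of endomorphisms as tensors, and their values at characters -/

section MatrixCoefficients

variable {𝕜 R X : Type*} [Field 𝕜] [CommRing R] [Algebra 𝕜 R]

/-- The `R`-valued function on `X` defined by a tensor in `A ⊗ R`, for an algebra `A` of
functions on `X`. -/
noncomputable def tensorEval (R : Type*) [CommRing R] [Algebra 𝕜 R] (A : Subalgebra 𝕜 (X → 𝕜)) :
    A ⊗[𝕜] R →ₐ[𝕜] (X → R) :=
  Algebra.TensorProduct.productMap (((Algebra.ofId 𝕜 R).compLeft X).comp A.val)
    (Pi.constAlgHom 𝕜 X R)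

@[simp]
theorem tensorEval_tmul (A : Subalgebra 𝕜 (X → 𝕜)) (a : A) (r : R) (x : X) :
    tensorEval R A (a ⊗ₜ r) x = (a : X → 𝕜) x • r := by
  simp [tensorEval, Algebra.smul_def, Algebra.ofId_apply]

/-- Evaluation of a tensor in `A ⊗ R` at a point `χ` of `A`. -/
noncomputable def tensorPoint (R : Type*) [CommRing R] [Algebra 𝕜 R]
    {A : Subalgebra 𝕜 (X → 𝕜)} (χ : A →ₐ[𝕜] 𝕜) : A ⊗[𝕜] R →ₐ[𝕜] R :=
  Algebra.TensorProduct.productMap ((Algebra.ofId 𝕜 R).comp χ) (AlgHom.id 𝕜 R)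

@[simp]
theorem tensorPoint_tmul {A : Subalgebra 𝕜 (X → 𝕜)} (χ : A →ₐ[𝕜] 𝕜) (a : A) (r : R) :
    tensorPoint R χ (a ⊗ₜ r) = χ a • r := by
  simp [tensorPoint, Algebra.smul_def, Algebra.ofId_apply]

theorem exists_tensor_coeff (A : Subalgebra 𝕜 (X → 𝕜)) (ℓ : Module.Dual 𝕜 R) (t : A ⊗[𝕜] R) :
    ∃ a : A, (∀ x, (a : X → 𝕜) x = ℓ (tensorEval R A t x)) ∧
      ∀ χ : A →ₐ[𝕜] 𝕜, χ a = ℓ (tensorPoint R χ t) := by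
  induction t using TensorProduct.induction_on with
  | zero => exact ⟨0, by simp, by simp⟩
  | tmul a r => exact ⟨ℓ r • a, fun x => by simp [mul_comm], fun χ => by simp [mul_comm]⟩
  | add t t' ht ht' =>
    obtain ⟨a, h1, h2⟩ := ht
    obtain ⟨a', h1', h2'⟩ := ht'
    exact ⟨a + a', fun x => by simp [h1, h1'], fun χ => by simp [h2, h2']⟩

theorem coeff_mem_of_mem_range {A : Subalgebra 𝕜 (X → 𝕜)} {F : X → R}
    (hF : F ∈ (tensorEval R A).range) (ℓ : Module.Dual 𝕜 R) : (fun x => ℓ (F x)) ∈ A := by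
  obtain ⟨t, rfl⟩ := AlgHom.mem_range _ |>.1 hF
  obtain ⟨a, h, -⟩ := exists_tensor_coeff A ℓ t
  have : (a : X → 𝕜) = fun x => ℓ (tensorEval R A t x) := funext h
  exact this ▸ a.2

theorem apply_tensorPoint {A : Subalgebra 𝕜 (X → 𝕜)} (χ : A →ₐ[𝕜] 𝕜) (ℓ : Module.Dual 𝕜 R)
    (t : A ⊗[𝕜] R) (a : A) (h : ∀ x, (a : X → 𝕜) x = ℓ (tensorEval R A t x)) :
    ℓ (tensorPoint R χ t) = χ a := by
  obtain ⟨b, hb, hχ⟩ := exists_tensor_coeff A ℓ t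
  rw [← hχ]
  congr 1
  exact Subtype.ext (funext fun x => (hb x).trans (h x).symm)

theorem eq_of_forall_dual {r r' : R} (h : ∀ ℓ : Module.Dual 𝕜 R, ℓ r = ℓ r') : r = r' := by
  rw [← sub_eq_zero, ← Module.forall_dual_apply_eq_zero_iff 𝕜]
  intro ℓ
  rw [map_sub, h, sub_self]

/-- Linear forms separate points of `R`, and each form turns a tensor into an element of `A`, which
is determined by its values on `X`. -/
theorem tensorPoint_eq_of_tensorEval_eq {A : Subalgebra 𝕜 (X → 𝕜)} (χ : A →ₐ[𝕜] 𝕜)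
    {t t' : A ⊗[𝕜] R} (h : tensorEval R A t = tensorEval R A t') :
    tensorPoint R χ t = tensorPoint R χ t' := by
  refine eq_of_forall_dual (𝕜 := 𝕜) fun ℓ => ?_
  obtain ⟨a, ha, -⟩ := exists_tensor_coeff A ℓ t
  rw [apply_tensorPoint χ ℓ t a ha, apply_tensorPoint χ ℓ t' a (by rwa [← h])]

/-- The elements with regular orbit map form a subalgebra, the preimage of a range under `AlgHom.pi
Φ`. -/
theorem orbit_mem_range {A : Subalgebra 𝕜 (X → 𝕜)} (Φ : X → R →ₐ[𝕜] R) {s : Set R}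
    (hs : Algebra.adjoin 𝕜 s = ⊤) (h : ∀ f ∈ s, (fun x => Φ x f) ∈ (tensorEval R A).range)
    (f : R) : (fun x => Φ x f) ∈ (tensorEval R A).range := by
  have hle : Algebra.adjoin 𝕜 s ≤ (tensorEval R A).range.comap (AlgHom.pi Φ) :=
    Algebra.adjoin_le h
  rw [hs] at hle
  exact hle (Algebra.mem_top (x := f))

theorem sum_smul_mem_range {A : Subalgebra 𝕜 (X → 𝕜)} {J : Type*} [Fintype J] {F : X → R}
    {c : J → X → 𝕜} {b : J → R} (hc : ∀ j, c j ∈ A) (hF : ∀ x, F x = ∑ j, c j x • b j) :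
    F ∈ (tensorEval R A).range := by
  refine AlgHom.mem_range _ |>.2 ⟨∑ j, (⟨c j, hc j⟩ : A) ⊗ₜ b j, ?_⟩
  ext x
  rw [map_sum, Finset.sum_apply, hF]
  simp

/-- The endomorphism of `R` at a point `χ` of an algebra containing the matrix coefficients of a
family of endomorphisms. -/
theorem exists_algHom_at_point {A : Subalgebra 𝕜 (X → 𝕜)} (χ : A →ₐ[𝕜] 𝕜) (Φ : X → R →ₐ[𝕜] R)
    (hΦ : ∀ f, (fun x => Φ x f) ∈ (tensorEval R A).range) :
    ∃ φ : R →ₐ[𝕜] R, ∀ f t, tensorEval R A t = (fun x => Φ x f) → φ f = tensorPoint R χ t := by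
  choose T hT using fun f => AlgHom.mem_range _ |>.1 (hΦ f)
  have hT' : ∀ {f t}, tensorEval R A t = (fun x => Φ x f) →
      tensorPoint R χ (T f) = tensorPoint R χ t := fun ht =>
    tensorPoint_eq_of_tensorEval_eq χ ((hT _).trans ht.symm)
  let φ : R →ₗ[𝕜] R :=
    { toFun := fun f => tensorPoint R χ (T f)
      map_add' := fun f f' => by
        rw [hT' (t := T f + T f') (by rw [map_add, hT, hT]; ext x; simp), map_add]
      map_smul' := fun c f => by
        rw [hT' (t := c • T f) (by rw [map_smul, hT]; ext x; simp), map_smul]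
        rfl }
  refine ⟨AlgHom.ofLinearMap φ ?_ ?_, fun f t ht => hT' ht⟩
  · change tensorPoint R χ (T 1) = 1
    rw [hT' (t := 1) (by rw [map_one]; ext x; simp), map_one]
  · intro f f'
    change tensorPoint R χ (T (f * f')) = tensorPoint R χ (T f) * tensorPoint R χ (T f')
    rw [hT' (t := T f * T f') (by rw [map_mul, hT, hT]; ext x; simp), map_mul]

theorem algHom_at_point_comp_eq_id {A : Subalgebra 𝕜 (X → 𝕜)} (χ : A →ₐ[𝕜] 𝕜)
    {Φ Φ' : X → R →ₐ[𝕜] R} (hΦ : ∀ f, (fun x => Φ x f) ∈ (tensorEval R A).range)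
    (hΦ' : ∀ f, (fun x => Φ' x f) ∈ (tensorEval R A).range) {φ φ' : R →ₐ[𝕜] R}
    (hφ : ∀ f t, tensorEval R A t = (fun x => Φ x f) → φ f = tensorPoint R χ t)
    (hφ' : ∀ f t, tensorEval R A t = (fun x => Φ' x f) → φ' f = tensorPoint R χ t)
    (hinv : ∀ x f, Φ x (Φ' x f) = f) (f : R) : φ (φ' f) = f := by
  -- Applying the family pointwise to a regular map gives a regular map, compatibly with evaluation
  -- at `χ`. The composite family is then compared with the constant map `1 ⊗ f`.
  have key : ∀ s : A ⊗[𝕜] R, ∃ u : A ⊗[𝕜] R,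
      (∀ x, tensorEval R A u x = Φ x (tensorEval R A s x)) ∧
        tensorPoint R χ u = φ (tensorPoint R χ s) := by
    intro s
    induction s using TensorProduct.induction_on with
    | zero => exact ⟨0, by simp, by simp⟩
    | tmul a r =>
      obtain ⟨t, ht⟩ := AlgHom.mem_range _ |>.1 (hΦ r)
      refine ⟨a ⊗ₜ 1 * t, fun x => ?_, ?_⟩
      · rw [map_mul, Pi.mul_apply, ht]
        simp
      · rw [map_mul, tensorPoint_tmul, tensorPoint_tmul, map_smul, hφ r t ht]
        simp
    | add s s' hs hs' =>
      obtain ⟨u, h1, h2⟩ := hs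
      obtain ⟨u', h1', h2'⟩ := hs'
      exact ⟨u + u', fun x => by simp [h1, h1'], by simp [h2, h2']⟩
  obtain ⟨t, ht⟩ := AlgHom.mem_range _ |>.1 (hΦ' f)
  obtain ⟨u, hu, huφ⟩ := key t
  have h1 : tensorEval R A u = tensorEval R A (1 ⊗ₜ f) := by
    ext x
    rw [hu, ht, hinv]
    simp
  rw [hφ' f t ht, ← huφ, tensorPoint_eq_of_tensorEval_eq χ h1]
  simp

theorem apply_algHom_at_point {A : Subalgebra 𝕜 (X → 𝕜)} (χ : A →ₐ[𝕜] 𝕜)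
    {Φ : X → R →ₐ[𝕜] R} (hΦ : ∀ f, (fun x => Φ x f) ∈ (tensorEval R A).range) {φ : R →ₐ[𝕜] R}
    (hφ : ∀ f t, tensorEval R A t = (fun x => Φ x f) → φ f = tensorPoint R χ t)
    (ℓ : Module.Dual 𝕜 R) (f : R) (a : A) (ha : ∀ x, (a : X → 𝕜) x = ℓ (Φ x f)) :
    ℓ (φ f) = χ a := by
  obtain ⟨t, ht⟩ := AlgHom.mem_range _ |>.1 (hΦ f)
  rw [hφ f t ht]
  exact apply_tensorPoint χ ℓ t a fun x => by rw [ha, ht]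

end MatrixCoefficients

/-! ### The dimension bound for block diagonal families -/

section BlockMatrices

variable {𝕜 R X : Type*} [Field 𝕜] [CommRing R] [Algebra 𝕜 R]

/-- The algebra generated by the matrix coefficients of a family of block diagonal automorphisms
and of their inverses has dimension at most the sum of the squares of the block sizes. -/
theorem ringKrullDim_le_of_blocks {Ω : Type*} [Fintype Ω] (d : Ω → ℕ)
    (b : ∀ w, Fin (d w) → R) (c : ∀ w, Fin (d w) → Module.Dual 𝕜 R)
    (hcb : ∀ w i j, c w i (b w j) = if i = j then 1 else 0)
    (hgen : Algebra.adjoin 𝕜 (Set.range fun j : Σ w, Fin (d w) => b j.1 j.2) = ⊤)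
    (Φ : X → R ≃ₐ[𝕜] R)
    (hΦ : ∀ x w j, Φ x (b w j) = ∑ i, c w i (Φ x (b w j)) • b w i)
    (hΦ' : ∀ x w j, (Φ x).symm (b w j) = ∑ i, c w i ((Φ x).symm (b w j)) • b w i)
    (S : Subalgebra 𝕜 (X → 𝕜))
    (hS : S = Algebra.adjoin 𝕜 {u | ∃ (f : R) (ℓ : Module.Dual 𝕜 R),
      (u = fun x => ℓ (Φ x f)) ∨ (u = fun x => ℓ ((Φ x).symm f))}) :
    ringKrullDim S ≤ ((∑ w, d w ^ 2 : ℕ) : WithBot ℕ∞) := by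
  have hmem : ∀ f (ℓ : Module.Dual 𝕜 R), (fun x => ℓ (Φ x f)) ∈ S := fun f ℓ =>
    hS ▸ Algebra.subset_adjoin ⟨f, ℓ, Or.inl rfl⟩
  have hmem' : ∀ f (ℓ : Module.Dual 𝕜 R), (fun x => ℓ ((Φ x).symm f)) ∈ S := fun f ℓ =>
    hS ▸ Algebra.subset_adjoin ⟨f, ℓ, Or.inr rfl⟩
  let ι := Σ w, Fin (d w) × Fin (d w)
  let M (w : Ω) : Matrix (Fin (d w)) (Fin (d w)) S := .of fun i j => ⟨_, hmem (b w j) (c w i)⟩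
  let N (w : Ω) : Matrix (Fin (d w)) (Fin (d w)) S := .of fun i j => ⟨_, hmem' (b w j) (c w i)⟩
  let Q (w : Ω) : Matrix (Fin (d w)) (Fin (d w)) (MvPolynomial ι 𝕜) :=
    .of fun i j => MvPolynomial.X ⟨w, i, j⟩
  let F : MvPolynomial ι 𝕜 →ₐ[𝕜] S := MvPolynomial.aeval fun k => M k.1 k.2.1 k.2.2
  have hFQ : ∀ w, F.mapMatrix (Q w) = M w := fun w => by
    ext1 i j
    simp [F, Q]
  have hMN : ∀ w, M w * N w = 1 := fun w => by
    ext i j x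
    have h1 : c w i (Φ x ((Φ x).symm (b w j))) = if i = j then 1 else 0 := by
      rw [AlgEquiv.apply_symm_apply, hcb]
    rw [hΦ', map_sum, map_sum] at h1
    rw [Matrix.mul_apply, Matrix.one_apply]
    have h2 : ((∑ k, M w i k * N w k j : S) : X → 𝕜) x =
        ∑ k, c w i (Φ x (b w k)) * c w k ((Φ x).symm (b w j)) := by
      rw [AddSubmonoidClass.coe_finsetSum, Finset.sum_apply]
      rfl
    rw [h2]
    trans (if i = j then (1 : 𝕜) else 0)
    · rw [← h1]
      exact Finset.sum_congr rfl fun k _ => by rw [map_smul, map_smul, smul_eq_mul, mul_comm]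
    · split_ifs <;> rfl
  have hunit : ∀ w, IsUnit (F (Q w).det) := fun w => by
    rw [AlgHom.map_det, hFQ]
    exact Matrix.isUnit_det_of_right_inverse (hMN w)
  -- Cramer's rule: the entries of the inverse block `N w` are cofactors of the generic block over
  -- its determinant.
  have hadj : ∀ w i j, F (Q w).det * N w i j = F ((Q w).adjugate i j) := fun w i j => by
    have h1 : F.mapMatrix (Q w).adjugate = (M w).det • N w := by
      rw [AlgHom.map_adjugate, hFQ, ← Matrix.mul_one (M w).adjugate, ← hMN w, ← Matrix.mul_assoc,
        Matrix.adjugate_mul, Matrix.smul_mul, Matrix.one_mul]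
    have h2 := congrFun (congrFun h1 i) j
    rw [AlgHom.map_det, hFQ]
    exact h2.symm
  have hfrac : S ≤ (fractionSubalgebra F).map S.val := by
    have hM : ∀ w i j, (fun x => c w i (Φ x (b w j))) ∈ (fractionSubalgebra F).map S.val :=
      fun w i j => ⟨M w i j, ⟨1, MvPolynomial.X ⟨w, i, j⟩, by simp, by simp [F]⟩, rfl⟩
    have hN : ∀ w i j, (fun x => c w i ((Φ x).symm (b w j))) ∈
        (fractionSubalgebra F).map S.val :=
      fun w i j => ⟨N w i j, ⟨(Q w).det, (Q w).adjugate i j, hunit w, hadj w i j⟩, rfl⟩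
    conv_lhs => rw [hS]
    refine Algebra.adjoin_le ?_
    rintro _ ⟨f, ℓ, rfl | rfl⟩
    · refine coeff_mem_of_mem_range (orbit_mem_range (fun x => (Φ x : R →ₐ[𝕜] R)) hgen ?_ f) ℓ
      rintro _ ⟨j, rfl⟩
      exact sum_smul_mem_range (fun i => hM j.1 i j.2) fun x => hΦ x j.1 j.2
    · refine coeff_mem_of_mem_range
        (orbit_mem_range (fun x => ((Φ x).symm : R →ₐ[𝕜] R)) hgen ?_ f) ℓ
      rintro _ ⟨j, rfl⟩
      exact sum_smul_mem_range (fun i => hN j.1 i j.2) fun x => hΦ' x j.1 j.2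
  have hdim := ringKrullDim_le_of_fractions (F : MvPolynomial ι 𝕜 →+* S) fun a => by
    obtain ⟨a', ha', h⟩ := hfrac a.2
    obtain rfl : a' = a := Subtype.ext h
    exact ha'
  refine hdim.trans_eq ?_
  rw [MvPolynomial.ringKrullDim_of_isNoetherianRing, ringKrullDim_eq_zero_of_field, zero_add]
  simp [ι, sq]

end BlockMatrices

section Functions

variable {𝕜 X Y : Type*} [Field 𝕜]

/-- The pullback of functions along a map. -/
def pullback (𝕜 : Type*) [Field 𝕜] (p : X → Y) : (Y → 𝕜) →ₐ[𝕜] (X → 𝕜) :=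
  AlgHom.pi fun x => Pi.evalAlgHom 𝕜 (fun _ : Y => 𝕜) (p x)

@[simp]
theorem pullback_apply (p : X → Y) (a : Y → 𝕜) (x : X) : pullback 𝕜 p a x = a (p x) := rfl

end Functions

/-- The coordinates on `V` are extended to linear forms on the whole space, so that they can serve
in matrix coefficients. -/
theorem exists_basis_and_dual {𝕜 R : Type*} [Field 𝕜] [AddCommGroup R] [Module 𝕜 R]
    (V : Submodule 𝕜 R) [Module.Finite 𝕜 V] :
    ∃ (b : Fin (Module.finrank 𝕜 V) → R) (c : Fin (Module.finrank 𝕜 V) → Module.Dual 𝕜 R),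
      (∀ i, b i ∈ V) ∧ (∀ f ∈ V, f = ∑ i, c i f • b i) ∧
        ∀ i j, c i (b j) = if i = j then 1 else 0 := by
  let B := Module.finBasis 𝕜 V
  choose c hc using fun i => LinearMap.exists_extend (B.coord i)
  have hc' : ∀ i (v : V), c i v = B.repr v i := fun i v => by
    rw [← Module.Basis.coord_apply, ← hc i]
    rfl
  refine ⟨fun i => B i, c, fun i => (B i).2, fun f hf => ?_, fun i j => ?_⟩
  · have h := congrArg Subtype.val (B.sum_repr ⟨f, hf⟩)
    rw [AddSubmonoidClass.coe_finsetSum] at h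
    refine h.symm.trans (Finset.sum_congr rfl fun i _ => ?_)
    rw [Submodule.coe_smul, ← hc' i ⟨f, hf⟩]
  · rw [hc', B.repr_self, Finsupp.single_apply]
    simp only [eq_comm]

/-! ### Graded automorphisms and the pieces with fixed `ψ` -/

section Aut

variable {𝕜 R K : Type*} [Field 𝕜] [CommRing R] [Algebra 𝕜 R] [AddCommGroup K]
  {𝒜 : K → Submodule 𝕜 R}

namespace GradedAut

theorem φ_inv_φ (g : GradedAut 𝒜) (f : R) : g.φ (g⁻¹.φ f) = f := g.φ.apply_symm_apply f

theorem inv_φ_φ (g : GradedAut 𝒜) (f : R) : g⁻¹.φ (g.φ f) = f := g.φ.symm_apply_apply f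

theorem φ_mem (g : GradedAut 𝒜) {w : K} {f : R} (hf : f ∈ 𝒜 w) : g.φ f ∈ 𝒜 (g.ψ w) :=
  (g.mem_iff w f).1 hf

theorem inv_φ_mem (g : GradedAut 𝒜) {w : K} {f : R} (hf : f ∈ 𝒜 (g.ψ w)) : g⁻¹.φ f ∈ 𝒜 w := by
  rw [g.mem_iff, φ_inv_φ]
  exact hf

theorem inv_ψ_ψ (g : GradedAut 𝒜) (w : K) : g⁻¹.ψ (g.ψ w) = w := g.ψ.symm_apply_apply w

theorem ψ_mem_weightMonoid (g : GradedAut 𝒜) {w : K} (hw : w ∈ weightMonoid 𝒜) :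
    g.ψ w ∈ weightMonoid 𝒜 := by
  obtain ⟨f, hf, hf0⟩ := exists_mem_ne_zero hw
  exact mem_weightMonoid_of_mem (g.φ_mem hf) (by simpa using hf0)

theorem weightLT_ψ (g : GradedAut 𝒜) {w' w : K} (h : weightLT 𝒜 w' w) :
    weightLT 𝒜 (g.ψ w') (g.ψ w) := by
  obtain ⟨⟨w₀, hw₀, rfl⟩, hne⟩ := h
  exact ⟨⟨g.ψ w₀, g.ψ_mem_weightMonoid hw₀, map_add _ _ _⟩, g.ψ.injective.ne hne⟩

theorem below_le_comap (g : GradedAut 𝒜) (w : K) :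
    below 𝒜 w ≤ (below 𝒜 (g.ψ w)).comap (g.φ : R →ₐ[𝕜] R) := by
  refine Algebra.adjoin_le ?_
  rintro f ⟨w', hw', hlt, hf⟩
  exact Algebra.subset_adjoin
    ⟨g.ψ w', g.ψ_mem_weightMonoid hw', g.weightLT_ψ hlt, g.φ_mem hf⟩

theorem ψ_mem_generatorDegrees (g : GradedAut 𝒜) {w : K} (hw : w ∈ generatorDegrees 𝒜) :
    g.ψ w ∈ generatorDegrees 𝒜 := by
  refine ⟨g.ψ_mem_weightMonoid hw.1, fun h => hw.2 fun f hf => ?_⟩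
  have h1 := g⁻¹.below_le_comap _ (h (g.φ_mem hf))
  rw [inv_ψ_ψ] at h1
  have h2 : g⁻¹.φ (g.φ f) ∈ below 𝒜 w := h1
  rwa [inv_φ_φ] at h2

theorem ψ_eq_of_forall_mem_weightMonoid (heff : IsEffective 𝒜) {ψ ψ' : K ≃+ K}
    (h : ∀ w ∈ weightMonoid 𝒜, ψ w = ψ' w) : ψ = ψ' := by
  have : (ψ : K →+ K) = ψ' := AddMonoidHom.eq_of_eqOn_dense heff h
  exact AddEquiv.ext fun w => DFunLike.congr_fun this w

variable [DecidableEq K] [GradedAlgebra 𝒜]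

/-- A nonzero element of `R_w` has a unique degree after applying `φ`, so `φ` fixes `ψ` on `ω(R)`,
which generates `K`. -/
theorem eq_of_φ_eq (heff : IsEffective 𝒜) {g h : GradedAut 𝒜} (hφ : g.φ = h.φ) : g = h := by
  refine GradedAut.ext hφ (ψ_eq_of_forall_mem_weightMonoid heff fun w hw => ?_)
  obtain ⟨f, hf, hf0⟩ := exists_mem_ne_zero hw
  exact eq_of_mem_of_mem (g.φ_mem hf) (hφ ▸ h.φ_mem hf) (by simpa using hf0)

end GradedAut

theorem coeff_mem_regularFunctions (f : R) (ℓ : Module.Dual 𝕜 R) :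
    (fun g : GradedAut 𝒜 => ℓ (g.φ f)) ∈ regularFunctions 𝒜 :=
  Algebra.subset_adjoin ⟨f, ℓ, Or.inl rfl⟩

theorem coeff_inv_mem_regularFunctions (f : R) (ℓ : Module.Dual 𝕜 R) :
    (fun g : GradedAut 𝒜 => ℓ (g⁻¹.φ f)) ∈ regularFunctions 𝒜 :=
  Algebra.subset_adjoin ⟨f, ℓ, Or.inr rfl⟩

theorem inv_mem_regularFunctions {a : GradedAut 𝒜 → 𝕜} (ha : a ∈ regularFunctions 𝒜) :
    (fun g => a g⁻¹) ∈ regularFunctions 𝒜 := by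
  have h : regularFunctions 𝒜 ≤ (regularFunctions 𝒜).comap (pullback 𝕜 fun g => g⁻¹) := by
    refine Algebra.adjoin_le ?_
    rintro _ ⟨f, ℓ, rfl | rfl⟩
    · exact coeff_inv_mem_regularFunctions f ℓ
    · exact coeff_mem_regularFunctions f ℓ
  exact h ha

section Restriction

/-- Restriction of regular functions to the graded automorphisms with a given action on the
grading group. -/
def restriction (𝒜 : K → Submodule 𝕜 R) (ψ : K ≃+ K) :
    regularFunctions 𝒜 →ₐ[𝕜] ({g : GradedAut 𝒜 // g.ψ = ψ} → 𝕜) :=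
  (pullback 𝕜 Subtype.val).comp (regularFunctions 𝒜).val

theorem iInf_ker_restriction :
    ⨅ ψ : Set.range (GradedAut.ψ : GradedAut 𝒜 → K ≃+ K), RingHom.ker (restriction 𝒜 ψ) = ⊥ := by
  rw [eq_bot_iff]
  intro a ha
  refine (Submodule.mem_bot _).2 (Subtype.ext (funext fun g => ?_))
  have h := (Submodule.mem_iInf _).1 ha ⟨g.ψ, g, rfl⟩
  exact congrFun ((RingHom.mem_ker).1 h) ⟨g, rfl⟩

/-- Translation by `g₀` only changes the form `ℓ` or the vector `f` in a coefficient. The translated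
family acts trivially on `K`, hence by block matrices. -/
theorem range_restriction (g₀ : GradedAut 𝒜) :
    (restriction 𝒜 g₀.ψ).range = Algebra.adjoin 𝕜 {u | ∃ (f : R) (ℓ : Module.Dual 𝕜 R),
      (u = fun x : {g : GradedAut 𝒜 // g.ψ = g₀.ψ} => ℓ ((g₀⁻¹ * x.1).φ f)) ∨
        (u = fun x => ℓ ((g₀⁻¹ * x.1).φ.symm f))} := by
  have h1 : (restriction 𝒜 g₀.ψ).range =
      (regularFunctions 𝒜).map (pullback 𝕜 Subtype.val) := by
    rw [restriction, AlgHom.range_comp, Subalgebra.range_val]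
  rw [h1, regularFunctions, AlgHom.map_adjoin]
  refine le_antisymm (Algebra.adjoin_mono ?_) (Algebra.adjoin_mono ?_)
  · rintro _ ⟨_, ⟨f, ℓ, rfl | rfl⟩, rfl⟩
    · refine ⟨f, ℓ ∘ₗ g₀.φ.toLinearMap, Or.inl (funext fun x => ?_)⟩
      change _ = ℓ (g₀.φ (g₀⁻¹.φ (x.1.φ f)))
      rw [g₀.φ_inv_φ]
      rfl
    · refine ⟨g₀⁻¹.φ f, ℓ, Or.inr (funext fun x => ?_)⟩
      change _ = ℓ (x.1⁻¹.φ (g₀.φ (g₀⁻¹.φ f)))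
      rw [g₀.φ_inv_φ]
      rfl
  · rintro _ ⟨f, ℓ, rfl | rfl⟩
    · exact ⟨_, ⟨f, ℓ ∘ₗ g₀⁻¹.φ.toLinearMap, Or.inl rfl⟩, rfl⟩
    · exact ⟨_, ⟨g₀.φ f, ℓ, Or.inr rfl⟩, rfl⟩

end Restriction

/-! ### The algebraic group structure and its dimension -/

variable [IsAlgClosed 𝕜] [IsDomain R] [Algebra.FiniteType 𝕜 R] [DecidableEq K] [GradedAlgebra 𝒜]

theorem IsPointed.finite_range_ψ (hpt : IsPointed 𝒜) (heff : IsEffective 𝒜) :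
    Finite (Set.range (GradedAut.ψ : GradedAut 𝒜 → K ≃+ K)) := by
  have := hpt.finite_generatorDegrees.to_subtype
  have hmaps : ∀ (ψ : Set.range (GradedAut.ψ : GradedAut 𝒜 → K ≃+ K))
      (w : generatorDegrees 𝒜), ψ.1 w ∈ generatorDegrees 𝒜 := by
    rintro ⟨_, g, rfl⟩ w
    exact g.ψ_mem_generatorDegrees w.2
  refine Finite.of_injective (fun ψ (w : generatorDegrees 𝒜) =>
    (⟨ψ.1 w, hmaps ψ w⟩ : generatorDegrees 𝒜)) fun ψ ψ' h => Subtype.ext ?_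
  have hgen : AddSubgroup.closure (generatorDegrees 𝒜) = ⊤ := by
    rw [← top_le_iff, ← heff]
    exact (AddSubgroup.closure_le _).2 hpt.weightMonoid_subset_closure
  have h1 : ((ψ : K ≃+ K) : K →+ K) = (ψ' : K ≃+ K) :=
    AddMonoidHom.eq_of_eqOn_dense hgen fun w hw =>
      congrArg Subtype.val (congrFun h ⟨w, hw⟩)
  exact AddEquiv.ext fun w => DFunLike.congr_fun h1 w

/-- A basis of the sum of the `R_w`, `w ∈ Ω_R`, works: this space generates `R` and is invariant
because `ψ` permutes `Ω_R`. -/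
theorem IsPointed.exists_invariant_generators (hpt : IsPointed 𝒜) :
    ∃ (n : ℕ) (b : Fin n → R) (c : Fin n → Module.Dual 𝕜 R),
      Algebra.adjoin 𝕜 (Set.range b) = ⊤ ∧
        ∀ (g : GradedAut 𝒜) j, g.φ (b j) = ∑ i, c i (g.φ (b j)) • b i := by
  have := hpt.finite_generatorDegrees.to_subtype
  have := hpt.finite_component
  let V : Submodule 𝕜 R := ⨆ w : generatorDegrees 𝒜, 𝒜 w
  have : Module.Finite 𝕜 V := Submodule.finite_iSup _
  obtain ⟨b, c, hb, hbc, -⟩ := exists_basis_and_dual V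
  refine ⟨_, b, c, ?_, fun g j => hbc _ ?_⟩
  · rw [← top_le_iff, ← hpt.adjoin_generatorDegrees]
    refine Algebra.adjoin_le (Set.iUnion₂_subset fun w hw f hf => ?_)
    rw [SetLike.mem_coe, hbc f (le_iSup (fun w : generatorDegrees 𝒜 => 𝒜 w) ⟨w, hw⟩ hf)]
    exact sum_mem fun i _ => Subalgebra.smul_mem _ (Algebra.subset_adjoin (Set.mem_range_self i)) _
  · have hle : V ≤ V.comap (g.φ : R →ₗ[𝕜] R) := iSup_le fun w f hf =>
      le_iSup (fun w : generatorDegrees 𝒜 => 𝒜 w) ⟨g.ψ w, g.ψ_mem_generatorDegrees w.2⟩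
        (g.φ_mem hf)
    exact hle (hb j)

theorem IsPointed.fg_regularFunctions (hpt : IsPointed 𝒜) : (regularFunctions 𝒜).FG := by
  obtain ⟨n, b, c, hgen, hbc⟩ := hpt.exists_invariant_generators
  let s : Set (GradedAut 𝒜 → 𝕜) :=
    (Set.range fun p : Fin n × Fin n => fun g : GradedAut 𝒜 => c p.1 (g.φ (b p.2))) ∪
      Set.range fun p : Fin n × Fin n => fun g : GradedAut 𝒜 => c p.1 (g⁻¹.φ (b p.2))
  refine Subalgebra.fg_def.2 ⟨s, (Set.finite_range _).union (Set.finite_range _),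
    le_antisymm (Algebra.adjoin_le ?_) (Algebra.adjoin_le ?_)⟩
  · rintro _ (⟨p, rfl⟩ | ⟨p, rfl⟩)
    · exact coeff_mem_regularFunctions _ _
    · exact coeff_inv_mem_regularFunctions _ _
  · rintro _ ⟨f, ℓ, rfl | rfl⟩
    · refine coeff_mem_of_mem_range
        (orbit_mem_range (fun g : GradedAut 𝒜 => (g.φ : R →ₐ[𝕜] R)) hgen ?_ f) ℓ
      rintro _ ⟨j, rfl⟩
      exact sum_smul_mem_range
        (fun i => Algebra.subset_adjoin (Or.inl ⟨(i, j), rfl⟩)) fun g => hbc g j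
    · refine coeff_mem_of_mem_range
        (orbit_mem_range (fun g : GradedAut 𝒜 => (g⁻¹.φ : R →ₐ[𝕜] R)) hgen ?_ f) ℓ
      rintro _ ⟨j, rfl⟩
      exact sum_smul_mem_range
        (fun i => Algebra.subset_adjoin (Or.inr ⟨(i, j), rfl⟩)) fun g => hbc g⁻¹ j

theorem IsPointed.orbit_mem_range (hpt : IsPointed 𝒜) (f : R) :
    (fun g : GradedAut 𝒜 => (g.φ : R →ₐ[𝕜] R) f) ∈
      (tensorEval R (regularFunctions 𝒜)).range := by
  obtain ⟨n, b, c, hgen, hbc⟩ := hpt.exists_invariant_generators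
  refine GradedAlg.orbit_mem_range (fun g : GradedAut 𝒜 => (g.φ : R →ₐ[𝕜] R)) hgen ?_ f
  rintro _ ⟨j, rfl⟩
  exact sum_smul_mem_range (fun i => coeff_mem_regularFunctions _ _) fun g => hbc g j

theorem IsPointed.orbit_inv_mem_range (hpt : IsPointed 𝒜) (f : R) :
    (fun g : GradedAut 𝒜 => (g⁻¹.φ : R →ₐ[𝕜] R) f) ∈
      (tensorEval R (regularFunctions 𝒜)).range := by
  obtain ⟨n, b, c, hgen, hbc⟩ := hpt.exists_invariant_generators
  refine GradedAlg.orbit_mem_range (fun g : GradedAut 𝒜 => (g⁻¹.φ : R →ₐ[𝕜] R)) hgen ?_ f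
  rintro _ ⟨j, rfl⟩
  exact sum_smul_mem_range (fun i => coeff_inv_mem_regularFunctions _ _) fun g => hbc g⁻¹ j

theorem IsPointed.mul_regularFunctions (hpt : IsPointed 𝒜) {a : GradedAut 𝒜 → 𝕜}
    (ha : a ∈ regularFunctions 𝒜) :
    ∃ (n : ℕ) (b c : Fin n → regularFunctions 𝒜), ∀ g h : GradedAut 𝒜,
      a (g * h) = ∑ i, (b i : GradedAut 𝒜 → 𝕜) g * (c i : GradedAut 𝒜 → 𝕜) h := by
  let A := regularFunctions 𝒜
  let μ : A ⊗[𝕜] A →ₐ[𝕜] (GradedAut 𝒜 × GradedAut 𝒜 → 𝕜) :=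
    Algebra.TensorProduct.productMap ((pullback 𝕜 Prod.fst).comp A.val)
      ((pullback 𝕜 Prod.snd).comp A.val)
  have hμ : ∀ (a b : A) g h, μ (a ⊗ₜ b) (g, h) =
      (a : GradedAut 𝒜 → 𝕜) g * (b : GradedAut 𝒜 → 𝕜) h := fun a b g h => by
    simp [μ]
  have hle : A ≤ μ.range.comap (pullback 𝕜 fun p => p.1 * p.2) := by
    refine Algebra.adjoin_le ?_
    rintro _ ⟨f, ℓ, rfl | rfl⟩
    · obtain ⟨t, ht⟩ := AlgHom.mem_range _ |>.1 (hpt.orbit_mem_range f)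
      -- Writing `h(f) = ∑ aᵢ(h) rᵢ` separates the variables: `ℓ(g(h(f))) = ∑ ℓ(g(rᵢ)) aᵢ(h)`.
      have key : ∀ t : A ⊗[𝕜] R, ∃ u, ∀ g h, μ u (g, h) = ℓ (g.φ (tensorEval R A t h)) := by
        intro t
        induction t using TensorProduct.induction_on with
        | zero => exact ⟨0, by simp⟩
        | tmul a r =>
          exact ⟨(⟨_, coeff_mem_regularFunctions r ℓ⟩ : A) ⊗ₜ a, fun g h => by
            simp [hμ, mul_comm]⟩
        | add t t' ht ht' =>
          obtain ⟨u, hu⟩ := ht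
          obtain ⟨u', hu'⟩ := ht'
          exact ⟨u + u', fun g h => by simp [hu, hu']⟩
      obtain ⟨u, hu⟩ := key t
      refine ⟨u, funext fun p => ?_⟩
      change μ u (p.1, p.2) = _
      rw [hu, ht]
      rfl
    · obtain ⟨t, ht⟩ := AlgHom.mem_range _ |>.1 (hpt.orbit_inv_mem_range f)
      -- Since `(gh)⁻¹ = h⁻¹g⁻¹`, it is now `g⁻¹(f)` that is expanded.
      have key : ∀ t : A ⊗[𝕜] R, ∃ u, ∀ g h, μ u (g, h) = ℓ (h⁻¹.φ (tensorEval R A t g)) := by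
        intro t
        induction t using TensorProduct.induction_on with
        | zero => exact ⟨0, by simp⟩
        | tmul a r =>
          exact ⟨a ⊗ₜ (⟨_, coeff_inv_mem_regularFunctions r ℓ⟩ : A), fun g h => by
            simp [hμ]⟩
        | add t t' ht ht' =>
          obtain ⟨u, hu⟩ := ht
          obtain ⟨u', hu'⟩ := ht'
          exact ⟨u + u', fun g h => by simp [hu, hu']⟩
      obtain ⟨u, hu⟩ := key t
      refine ⟨u, funext fun p => ?_⟩
      change μ u (p.1, p.2) = ℓ ((p.1 * p.2)⁻¹.φ f)
      rw [hu, ht, mul_inv_rev]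
      rfl
  obtain ⟨u, hu⟩ := hle ha
  obtain ⟨n, b, c, rfl⟩ := TensorProduct.exists_sum_tmul_eq u
  refine ⟨n, b, c, fun g h => ?_⟩
  have h1 : μ (∑ i, b i ⊗ₜ c i) (g, h) = a (g * h) := congrFun hu (g, h)
  rw [← h1, map_sum, Finset.sum_apply]
  exact Finset.sum_congr rfl fun i _ => hμ _ _ _ _

theorem IsPointed.exists_ker_restriction_le (hpt : IsPointed 𝒜) (heff : IsEffective 𝒜)
    (χ : regularFunctions 𝒜 →ₐ[𝕜] 𝕜) :
    ∃ ψ : K ≃+ K, RingHom.ker (restriction 𝒜 ψ) ≤ RingHom.ker χ := by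
  have := hpt.finite_range_ψ heff
  cases nonempty_fintype (Set.range (GradedAut.ψ : GradedAut 𝒜 → K ≃+ K))
  have hle : Finset.univ.inf (fun ψ : Set.range (GradedAut.ψ : GradedAut 𝒜 → K ≃+ K) =>
      RingHom.ker (restriction 𝒜 ψ)) ≤ RingHom.ker χ := by
    rw [Finset.inf_univ_eq_iInf, iInf_ker_restriction]
    exact bot_le
  obtain ⟨ψ, -, hψ⟩ := (Ideal.IsPrime.inf_le' (RingHom.ker_isPrime χ)).1 hle
  exact ⟨ψ, hψ⟩

theorem IsPointed.exists_eval_eq (hpt : IsPointed 𝒜) (heff : IsEffective 𝒜)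
    (χ : regularFunctions 𝒜 →ₐ[𝕜] 𝕜) :
    ∃ g : GradedAut 𝒜,
      (Pi.evalAlgHom 𝕜 (fun _ : GradedAut 𝒜 => 𝕜) g).comp (regularFunctions 𝒜).val = χ := by
  obtain ⟨ψ, hψ⟩ := hpt.exists_ker_restriction_le heff χ
  obtain ⟨φ, hφ⟩ := exists_algHom_at_point χ _ hpt.orbit_mem_range
  obtain ⟨φ', hφ'⟩ := exists_algHom_at_point χ _ hpt.orbit_inv_mem_range
  have hcoeff : ∀ (f : R) (ℓ : Module.Dual 𝕜 R),
      ℓ (φ f) = χ ⟨_, coeff_mem_regularFunctions f ℓ⟩ := fun f ℓ =>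
    apply_algHom_at_point χ hpt.orbit_mem_range hφ ℓ f _ fun _ => rfl
  have hcoeff' : ∀ (f : R) (ℓ : Module.Dual 𝕜 R),
      ℓ (φ' f) = χ ⟨_, coeff_inv_mem_regularFunctions f ℓ⟩ := fun f ℓ =>
    apply_algHom_at_point χ hpt.orbit_inv_mem_range hφ' ℓ f _ fun _ => rfl
  have hφφ' : ∀ f, φ (φ' f) = f := algHom_at_point_comp_eq_id χ hpt.orbit_mem_range
    hpt.orbit_inv_mem_range hφ hφ' fun g f => g.φ_inv_φ f
  have hφ'φ : ∀ f, φ' (φ f) = f := algHom_at_point_comp_eq_id χ hpt.orbit_inv_mem_range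
    hpt.orbit_mem_range hφ' hφ fun g f => g.inv_φ_φ f
  -- Otherwise some `ℓ` vanishes on `R_{ψ(w)}` but not at `φ f`. Its coefficient is zero on the
  -- piece of `ψ`, hence is killed by `χ`, a contradiction.
  have hmem : ∀ w, ∀ f ∈ 𝒜 w, φ f ∈ 𝒜 (ψ w) := fun w f hf => by
    by_contra h
    obtain ⟨ℓ, hne, hle⟩ := Submodule.exists_le_ker_of_notMem h
    refine hne ?_
    rw [hcoeff]
    refine hψ (RingHom.mem_ker.2 (funext fun ⟨g, hg⟩ => hle ?_))
    exact hg ▸ g.φ_mem hf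
  have hmem' : ∀ w, ∀ f ∈ 𝒜 (ψ w), φ' f ∈ 𝒜 w := fun w f hf => by
    by_contra h
    obtain ⟨ℓ, hne, hle⟩ := Submodule.exists_le_ker_of_notMem h
    refine hne ?_
    rw [hcoeff']
    refine hψ (RingHom.mem_ker.2 (funext fun ⟨g, hg⟩ => hle ?_))
    exact g.inv_φ_mem (hg.symm ▸ hf)
  let g : GradedAut 𝒜 :=
    { φ := AlgEquiv.ofAlgHom φ φ' (AlgHom.ext hφφ') (AlgHom.ext hφ'φ)
      ψ := ψ
      mem_iff := fun w f => ⟨hmem w f, fun h => hφ'φ f ▸ hmem' w _ h⟩ }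
  refine ⟨g, ?_⟩
  let E : regularFunctions 𝒜 →ₐ[𝕜] 𝕜 :=
    (Pi.evalAlgHom 𝕜 (fun _ : GradedAut 𝒜 => 𝕜) g).comp (regularFunctions 𝒜).val
  -- Evaluation at `g` and `χ` agree on the generating coefficients, hence everywhere.
  have hle : regularFunctions 𝒜 ≤ (AlgHom.equalizer E χ).map (regularFunctions 𝒜).val := by
    conv_lhs => rw [regularFunctions]
    refine Algebra.adjoin_le ?_
    rintro _ ⟨f, ℓ, rfl | rfl⟩
    · exact ⟨⟨_, coeff_mem_regularFunctions f ℓ⟩, hcoeff f ℓ, rfl⟩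
    · exact ⟨⟨_, coeff_inv_mem_regularFunctions f ℓ⟩, hcoeff' f ℓ, rfl⟩
  refine AlgHom.ext fun a => ?_
  obtain ⟨a', ha', h⟩ := hle a.2
  obtain rfl : a' = a := Subtype.ext h
  exact ha'

theorem IsPointed.isAffineAlgebraicGroup (hpt : IsPointed 𝒜) (heff : IsEffective 𝒜) :
    IsAffineAlgebraicGroup (regularFunctions 𝒜) where
  fg := hpt.fg_regularFunctions
  bijective_eval := by
    refine ⟨fun g h hgh => GradedAut.eq_of_φ_eq heff (AlgEquiv.ext fun f => ?_),
      hpt.exists_eval_eq heff⟩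
    exact eq_of_forall_dual (𝕜 := 𝕜) fun ℓ =>
      DFunLike.congr_fun hgh ⟨_, coeff_mem_regularFunctions f ℓ⟩
  mul _ ha := hpt.mul_regularFunctions ha
  inv _ ha := inv_mem_regularFunctions ha

theorem IsPointed.ringKrullDim_range_restriction_le (hpt : IsPointed 𝒜)
    [Fintype (generatorDegrees 𝒜)] (g₀ : GradedAut 𝒜) :
    ringKrullDim (restriction 𝒜 g₀.ψ).range ≤
      ((∑ w : generatorDegrees 𝒜, Module.finrank 𝕜 (𝒜 w) ^ 2 : ℕ) : WithBot ℕ∞) := by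
  have := hpt.finite_component
  choose b c hb hbc hcb using fun w : K => exists_basis_and_dual (𝒜 w)
  have hdeg : ∀ x : {g : GradedAut 𝒜 // g.ψ = g₀.ψ}, ∀ w, (g₀⁻¹ * x.1).ψ w = w := fun x w => by
    change g₀⁻¹.ψ (x.1.ψ w) = w
    rw [x.2, g₀.inv_ψ_ψ]
  have hmem : ∀ (x : {g : GradedAut 𝒜 // g.ψ = g₀.ψ}) w j,
      (g₀⁻¹ * x.1).φ (b w j) ∈ 𝒜 w := fun x w j => by
    have h := (g₀⁻¹ * x.1).φ_mem (hb w j)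
    rwa [hdeg] at h
  have hmem' : ∀ (x : {g : GradedAut 𝒜 // g.ψ = g₀.ψ}) w j,
      (g₀⁻¹ * x.1).φ.symm (b w j) ∈ 𝒜 w := fun x w j => by
    refine (g₀⁻¹ * x.1).inv_φ_mem ?_
    rw [hdeg]
    exact hb w j
  have hgen : Algebra.adjoin 𝕜 (Set.range fun j :
      Σ w : generatorDegrees 𝒜, Fin (Module.finrank 𝕜 (𝒜 w)) => b j.1 j.2) = ⊤ := by
    rw [← top_le_iff, ← hpt.adjoin_generatorDegrees]
    refine Algebra.adjoin_le (Set.iUnion₂_subset fun w hw f hf => ?_)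
    rw [SetLike.mem_coe, hbc w f hf]
    refine sum_mem fun i _ => Subalgebra.smul_mem _ (Algebra.subset_adjoin ?_) _
    exact ⟨⟨⟨w, hw⟩, i⟩, rfl⟩
  exact ringKrullDim_le_of_blocks (fun w : generatorDegrees 𝒜 => Module.finrank 𝕜 (𝒜 w))
    (fun w => b w) (fun w => c w) (fun w => hcb w) hgen
    (fun x : {g : GradedAut 𝒜 // g.ψ = g₀.ψ} => (g₀⁻¹ * x.1).φ)
    (fun x w j => hbc w _ (hmem x w j)) (fun x w j => hbc w _ (hmem' x w j)) _
    (range_restriction g₀)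

theorem IsPointed.algGroupDim_le (hpt : IsPointed 𝒜) (heff : IsEffective 𝒜) :
    algGroupDim (regularFunctions 𝒜) ≤
      ((∑ᶠ w ∈ generatorDegrees 𝒜, Module.finrank 𝕜 (𝒜 w) ^ 2 : ℕ) : WithBot ℕ∞) := by
  have := hpt.finite_range_ψ heff
  have := hpt.finite_generatorDegrees.fintype
  rw [← finsum_set_coe_eq_finsum_mem, finsum_eq_sum_of_fintype]
  refine ringKrullDim_le_of_iInf_ker_eq_bot
    (fun ψ : Set.range (GradedAut.ψ : GradedAut 𝒜 → K ≃+ K) =>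
      ((restriction 𝒜 ψ).rangeRestrict : regularFunctions 𝒜 →+* (restriction 𝒜 ψ).range))
    (fun ψ => (restriction 𝒜 ψ).rangeRestrict_surjective) ?_ ?_
  · rw [← iInf_ker_restriction]
    refine iInf_congr fun ψ => ?_
    ext a
    exact Subtype.ext_iff
  · rintro ⟨_, g₀, rfl⟩
    exact hpt.ringKrullDim_range_restriction_le g₀

end Aut

end GradedAlg

theorem corollary2 {𝕜 R K : Type*} [Field 𝕜] [IsAlgClosed 𝕜] [CharZero 𝕜]
    [CommRing R] [IsDomain R] [Algebra 𝕜 R] [Algebra.FiniteType 𝕜 R]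
    [AddCommGroup K] [AddGroup.FG K] [DecidableEq K]
    (𝒜 : K → Submodule 𝕜 R) [GradedAlgebra 𝒜]
    (heff : GradedAlg.IsEffective 𝒜) (hpt : GradedAlg.IsPointed 𝒜) :
    GradedAlg.IsAffineAlgebraicGroup (GradedAlg.regularFunctions 𝒜) ∧
    (GradedAlg.generatorDegrees 𝒜).Finite ∧
    (∀ w ∈ GradedAlg.generatorDegrees 𝒜, Module.Finite 𝕜 (𝒜 w)) ∧
    GradedAlg.algGroupDim (GradedAlg.regularFunctions 𝒜) ≤
      ((∑ᶠ w ∈ GradedAlg.generatorDegrees 𝒜, Module.finrank 𝕜 (𝒜 w) ^ 2 : ℕ) :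
        WithBot ℕ∞) :=
  ⟨hpt.isAffineAlgebraicGroup heff, hpt.finite_generatorDegrees,
    fun w _ => hpt.finite_component w, hpt.algGroupDim_le heff⟩
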